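/- Let $X$ be a nonempty topological space. The open-open game on $X$ of length $\kappa$ ($\kappa$ an infinite cardinal) has a round for every ordinal $\alpha<\kappa$: in round $\alpha$ Player I, knowing the earlier moves, chooses a nonempty open set, and Player II answers with a nonempty open subset $B_\alpha$ of it; Player I wins if $\bigcup_{\alpha<\kappa}B_\alpha$ is dense in $X$. Let $\mu(X)$ be the least infinite cardinal $\kappa$ such that Player I has a winning strategy in the game of length $\kappa$. A continuous surjection $f:Y\to Z$ is called skeletal if for every nonempty open $U\subseteq Y$ the closure of $f[U]$ has nonempty interior. A (nonempty) directed set $\Sigma$ is called $\tau$-complete if every chain in $\Sigma$ of cardinality at most $\tau$ has a least upper bound in $\Sigma$. Theorem. Let $X$ be a nonempty Tychonoff space with $\mu(X)=\kappa$, and let $\tau=\kappa^{<\kappa}$ if $\kappa$ is regular and $\tau=\kappa^{\kappa}$ otherwise. Then there is an inverse system $\{X_\sigma,\pi^\sigma_\varrho,\Sigma\}$ of topological spaces whose indexing set $\Sigma$ is a $\tau$-complete directed set, whose bonding maps $\pi^\sigma_\varrho$ are all skeletal, and in which each $X_\sigma$ is a Tychonoff space of weight at most $\tau$, such that $X$ is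 homeomorphic to a dense subspace of the inverse limit $\varprojlim\{X_\sigma,\pi^\sigma_\varrho,\Sigma\}$. -/

import Mathlib

open Set Cardinal Topology TopologicalSpace

universe u

namespace OpenOpenGame

/-- The nonempty open subsets of `X`. -/
abbrev NOpens (X : Type u) [TopologicalSpace X] : Type u :=
  {U : Opens X // (U : Set X).Nonempty}

/-- `X` is `κ`-favorable: Player I has a winning strategy `s` in the open-open game of length `κ`.
A round is played for every ordinal `α < κ`. In round `α`, Player I, who has seen the sequence
`⟨B γ : γ < α⟩` of the earlier moves of Player II, plays the nonempty open set
`s α ⟨B γ : γ < α⟩`, and Player II answers with a nonempty open subset `B α` of it.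
Player I wins if the union of all the sets `B α` is dense. -/
def Favorable (X : Type u) [TopologicalSpace X] (κ : Cardinal.{u}) : Prop :=
  ∃ s : ∀ α : Iio κ.ord, (Iio α → NOpens X) → NOpens X,
    ∀ B : Iio κ.ord → NOpens X,
      (∀ α, ((B α).1 : Set X) ⊆ ((s α fun γ => B γ).1 : Set X)) →
        Dense (⋃ α, ((B α).1 : Set X))

/-- `μ(X)`: the least infinite cardinal `κ` such that `X` is `κ`-favorable. -/
noncomputable def mu (X : Type u) [TopologicalSpace X] : Cardinal.{u} :=
  sInf {κ | ℵ₀ ≤ κ ∧ Favorable X κ}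

/-- For nonempty `X` the minimum defining `μ(X)` is attained. -/
theorem mu_spec (X : Type u) [TopologicalSpace X] [Nonempty X] :
    ℵ₀ ≤ mu X ∧ Favorable X (mu X) := by
  have : Nonempty (NOpens X) := ⟨⟨⊤, by simp⟩⟩
  refine csInf_mem (s := {κ | ℵ₀ ≤ κ ∧ Favorable X κ}) ⟨max ℵ₀ #(NOpens X), le_max_left _ _, ?_⟩
  have hle : Cardinal.lift.{u+1} #(NOpens X) ≤
      Cardinal.lift.{u} #(Iio (max ℵ₀ #(NOpens X)).ord) := by
    rw [Cardinal.mk_Iio_ordinal]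
    simp
  obtain ⟨e⟩ := Cardinal.lift_mk_le'.1 hle
  refine ⟨fun α _ => Function.invFun e α, fun B hB => ?_⟩
  rw [dense_iff_inter_open]
  intro U hU hne
  let V : NOpens X := ⟨⟨U, hU⟩, hne⟩
  obtain ⟨x, hx⟩ := (B (e V)).2
  have h := hB (e V) hx
  simp only [Function.leftInverse_invFun e.injective V] at h
  exact ⟨x, h, mem_iUnion.2 ⟨_, hx⟩⟩

/-- The weight of a topological space: the least cardinality of a base. -/
noncomputable def weight (X : Type u) [TopologicalSpace X] : Cardinal.{u} :=
  sInf {c | ∃ B : Set (Set X), IsTopologicalBasis B ∧ #B = c}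

open Classical in
/-- `κ^{<κ}` if `κ` is a regular cardinal, and `κ^κ` otherwise. -/
noncomputable def tau (κ : Cardinal.{u}) : Cardinal.{u} :=
  if κ.IsRegular then κ ^< κ else κ ^ κ

/-- A skeletal map: a continuous surjection such that the closure of the image of every nonempty
open set has nonempty interior. -/
def IsSkeletal {X Y : Type u} [TopologicalSpace X] [TopologicalSpace Y] (f : X → Y) : Prop :=
  Continuous f ∧ Function.Surjective f ∧
    ∀ U : Set X, IsOpen U → U.Nonempty → (interior (closure (f '' U))).Nonempty

/-- A `τ`-complete directed set: a nonempty directed partially ordered set in which every chain of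
cardinality at most `τ` has a least upper bound. -/
def IsCompleteDirected (I : Type u) [PartialOrder I] (τ : Cardinal.{u}) : Prop :=
  Nonempty I ∧ IsDirectedOrder I ∧
    ∀ A : Set I, IsChain (· ≤ ·) A → #A ≤ τ → ∃ σ, IsLUB A σ

/-- An inverse system of topological spaces, with continuous bonding maps
`bond : space j → space i` for `i ≤ j`. -/
structure InvSystem (I : Type u) [PartialOrder I] where
  space : I → Type u
  [top : ∀ i, TopologicalSpace (space i)]
  bond : ∀ ⦃i j : I⦄, i ≤ j → space j → space i
  continuous_bond : ∀ ⦃i j : I⦄ (h : i ≤ j), Continuous (bond h)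
  bond_self : ∀ (i : I) (x : space i), bond (le_refl i) x = x
  bond_bond : ∀ ⦃i j k : I⦄ (hij : i ≤ j) (hjk : j ≤ k) (x : space k),
    bond hij (bond hjk x) = bond (hij.trans hjk) x

attribute [instance] InvSystem.top

/-- The inverse limit: the space of threads, as a subspace of the product. -/
abbrev InvSystem.Limit {I : Type u} [PartialOrder I] (S : InvSystem I) : Type u :=
  {x : ∀ i, S.space i // ∀ ⦃i j : I⦄ (h : i ≤ j), S.bond h (x j) = x i}

end OpenOpenGame

/-! ### Cardinal arithmetic and closure under infinitary operations -/

namespace OpenOpenGame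

/-! Complete regularity lets both players choose continuous functions, read as their positivity
sets. The indices are the sets `F` of at most `τ` functions closed under Player I's winning strategy
and under `band`; the space at `F` is the image of `X` in `ℝ ^ F`. Closure under `band` makes the
positivity sets of members of `F` a base of the image (`BandClosed.isTopologicalBasis`). Closure
under the strategy makes `X → EvalImage F` skeletal (`isSkeletal_toEvalImage`), and the bonding maps
inherit this. Moves have fewer than `κ` arguments and `τ ^ l ≤ τ` for `l < κ`, so every set of at
most `τ` functions generates an index (`exists_functionIndex`). This yields completeness, and
indices containing any given function, so that `X` embeds in the limit. -/

theorem powerlt_power_le {κ l : Cardinal.{u}} (hκ : κ.IsRegular) (hl : l < κ) :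
    (κ ^< κ) ^ l ≤ κ ^< κ := by
  let c : κ.ord.ToType → Cardinal.{u} := fun a => (a.toOrd : Ordinal.{u}).card
  have hc : ∀ a, c a < κ := fun a => lt_ord.1 a.toOrd.2
  have hκ0 := hκ.aleph0_le
  have hmul : κ * κ ^< κ ≤ κ ^< κ := by
    have : κ ≤ κ ^< κ := by
      simpa using le_powerlt κ (one_lt_aleph0.trans_le hκ0)
    exact (mul_le_mul_left this _).trans (mul_eq_self (hκ0.trans this)).le
  have h1 : κ ^< κ ≤ sum fun a => κ ^ c a := by
    refine powerlt_le.2 fun x hx => ?_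
    have h : c (Ordinal.ToType.mk ⟨x.ord, ord_lt_ord.2 hx⟩) = x := by simp [c]
    calc κ ^ x = κ ^ c (Ordinal.ToType.mk ⟨x.ord, ord_lt_ord.2 hx⟩) := by rw [h]
      _ ≤ _ := le_sum (fun a => κ ^ c a) _
  obtain ⟨g⟩ : Nonempty ((κ ^< κ).out ↪ Σ a, (κ ^ c a).out) := by
    rw [← Cardinal.le_def]; simpa using h1
  -- An increasing filtration of length `κ`. By regularity each map from `l < κ` lands in one stage,
  -- and a stage has size at most `κ ^ (1 + c b)`, with exponent below `κ`.
  let Y : κ.ord.ToType → Set (κ ^< κ).out := fun b => {y | (g y).1 ≤ b}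
  have hY : ∀ b, #(Y b) ≤ κ * κ ^ c b := fun b => by
    let e : Y b → Σ a : Iic b, (κ ^ c a).out := fun y => ⟨⟨(g y).1, y.2⟩, (g y).2⟩
    have he : Function.Injective e := by
      rintro ⟨y, hy⟩ ⟨z, hz⟩ h
      simp only [e, Sigma.mk.injEq] at h
      exact Subtype.ext (g.injective (Sigma.ext (congrArg Subtype.val h.1) h.2))
    calc #(Y b) ≤ #(Σ a : Iic b, (κ ^ c a).out) := mk_le_of_injective he
      _ = sum fun a : Iic b => κ ^ c a := by simp
      _ ≤ sum fun _ : Iic b => κ ^ c b := sum_le_sum _ _ fun a =>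
          power_le_power_left hκ.ne_zero (Ordinal.card_le_card
            (Subtype.coe_le_coe.2 (Ordinal.ToType.mk.symm.monotone a.2)))
      _ = #(Iic b) * κ ^ c b := by simp
      _ ≤ _ := by
          gcongr
          simpa using mk_set_le (Iic b)
  let p : (Σ b, l.out → Y b) → l.out → (κ ^< κ).out := fun q i => q.2 i
  have hp : Function.Surjective p := fun f => by
    have hlt : ⨆ i, ((g (f i)).1.toOrd : Ordinal.{u}) < κ.ord :=
      Ordinal.iSup_lt_of_lt_cof (by simpa [hκ.cof_ord] using hl) fun i => (g (f i)).1.toOrd.2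
    refine ⟨⟨Ordinal.ToType.mk ⟨_, hlt⟩, fun i => ⟨f i, ?_⟩⟩, rfl⟩
    exact (OrderIso.symm_apply_le Ordinal.ToType.mk).1 (Subtype.coe_le_coe.1
      (Ordinal.le_iSup (fun i => ((g (f i)).1.toOrd : Ordinal.{u})) i))
  have power_one_add : ∀ d : Cardinal.{u}, κ ^ (1 + d) = κ * κ ^ d := fun d => by
    rw [power_add, power_one]
  calc (κ ^< κ) ^ l = #(l.out → (κ ^< κ).out) := by simp
    _ ≤ #(Σ b, l.out → Y b) := mk_le_of_surjective hp
    _ = sum fun b => #(Y b) ^ l := by simp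
    _ ≤ sum fun _ : κ.ord.ToType => κ ^< κ := sum_le_sum _ _ fun b => by
        refine (power_le_power_right (hY b)).trans ?_
        rw [← power_one_add, ← power_mul]
        exact le_powerlt κ (mul_lt_of_lt hκ0
          (add_lt_of_lt hκ0 (one_lt_aleph0.trans_le hκ0) (hc b)) hl)
    _ = κ * κ ^< κ := by simp
    _ ≤ _ := hmul

theorem le_tau {κ : Cardinal.{u}} (hκ : ℵ₀ ≤ κ) : κ ≤ tau κ := by
  have h1 := one_lt_aleph0.trans_le hκ
  unfold tau
  split_ifs
  · simpa using le_powerlt κ h1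
  · exact self_le_power κ h1.le

theorem tau_power_le {κ l : Cardinal.{u}} (hκ : ℵ₀ ≤ κ) (hl : l < κ) : tau κ ^ l ≤ tau κ := by
  unfold tau
  split_ifs with h
  · exact powerlt_power_le h hl
  · rw [← power_mul]
    exact power_le_power_left (aleph0_pos.trans_le hκ).ne' ((mul_le_mul_right hl.le κ).trans (mul_eq_self hκ).le)

/-- The sets closed under a family of operations, possibly infinitary. -/
def OpClosed {C J : Type u} {ar : J → Type u} (op : ∀ j, (ar j → C) → C) (F : Set C) : Prop :=
  ∀ j (a : ar j → C), (∀ i, a i ∈ F) → op j a ∈ F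

/-- The set generated by `A` under a family of operations. -/
def opClosure {C J : Type u} {ar : J → Type u} (op : ∀ j, (ar j → C) → C) (A : Set C) : Set C :=
  ⋂₀ {F | A ⊆ F ∧ OpClosed op F}

section
variable {C J : Type u} {ar : J → Type u} (op : ∀ j, (ar j → C) → C) (A : Set C)

theorem subset_opClosure : A ⊆ opClosure op A := subset_sInter fun _ h => h.1

variable {A} in
theorem opClosure_subset {F : Set C} (hA : A ⊆ F) (hF : OpClosed op F) : opClosure op A ⊆ F :=
  sInter_subset_of_mem ⟨hA, hF⟩

theorem opClosed_opClosure : OpClosed op (opClosure op A) :=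
  fun j a ha => mem_sInter.2 fun _ h => h.2 j a fun i => opClosure_subset op h.1 h.2 (ha i)

variable {A} in
-- Every generated element is the value of a well-founded term with leaves in `A` and nodes in `J`,
-- so it suffices to count terms.
theorem mk_opClosure_le {τ : Cardinal.{u}} (hτ : ℵ₀ ≤ τ) (hJ : #J ≤ τ)
    (har : ∀ j, τ ^ #(ar j) ≤ τ) (hA : #A ≤ τ) : #(opClosure op A) ≤ τ := by
  let β : A ⊕ J → Type u := Sum.elim (fun _ => PEmpty) ar
  let e : WType β → C := WType.elim C fun p => match p with
    | ⟨.inl a, _⟩ => a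
    | ⟨.inr j, f⟩ => op j f
  have hsub : opClosure op A ⊆ range e := by
    refine opClosure_subset op (fun a ha => ⟨⟨.inl ⟨a, ha⟩, PEmpty.elim⟩, rfl⟩) ?_
    intro j a ha
    choose w hw using ha
    refine ⟨⟨.inr j, w⟩, ?_⟩
    change op j (fun i => e (w i)) = _
    simp_rw [hw]
  refine (mk_le_mk_of_subset hsub).trans (mk_range_le.trans (WType.cardinalMk_le_of_le ?_))
  calc (sum fun a => τ ^ #(β a)) ≤ sum fun _ : A ⊕ J => τ := sum_le_sum _ _ fun a => by
        rcases a with a | j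
        · simpa [β] using one_le_aleph0.trans hτ
        · exact har j
    _ = (#A + #J) * τ := by simp
    _ ≤ τ := mul_le_of_le hτ (add_le_of_le hτ hA hJ) le_rfl
end

end OpenOpenGame

/-! ### Images of the space under families of functions -/

namespace OpenOpenGame

section
variable {X : Type u} [TopologicalSpace X]

/-- The open set on which `f` is positive. -/
def posSet (f : C(X, ℝ)) : Opens X := ⟨{x | 0 < f x}, isOpen_lt continuous_const f.continuous⟩

@[simp]
theorem mem_posSet {f : C(X, ℝ)} {x : X} : x ∈ posSet f ↔ 0 < f x := Iff.rfl

/-- The function which is positive where `p < f < q` and `g > 0`. -/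
def band (p q : ℝ) (f g : C(X, ℝ)) : C(X, ℝ) :=
  (f - ContinuousMap.const X p) ⊓ (ContinuousMap.const X q - f) ⊓ g

theorem band_apply (p q : ℝ) (f g : C(X, ℝ)) (x : X) :
    band p q f g x = min (min (f x - p) (q - f x)) (g x) := rfl

theorem exists_posSet_subset [CompletelyRegularSpace X] {U : Set X} (hU : IsOpen U) {x : X}
    (hx : x ∈ U) : ∃ f : C(X, ℝ), x ∈ posSet f ∧ (posSet f : Set X) ⊆ U := by
  obtain ⟨f, hf, hf0, hf1⟩ := CompletelyRegularSpace.completely_regular_isOpen x U hU hx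
  refine ⟨⟨fun y => 1 - f y, by fun_prop⟩, by simp [hf0], fun y hy => ?_⟩
  by_contra h
  have h1 : f y = 1 := hf1 h
  simp [h1] at hy

/-- The image of `X` in `ℝ ^ F` under the evaluation map. -/
abbrev EvalImage (F : Set C(X, ℝ)) : Type u := range fun (x : X) (f : F) => f.1 x

/-- The evaluation map onto its image. -/
def toEvalImage (F : Set C(X, ℝ)) : X → EvalImage F := rangeFactorization _

theorem toEvalImage_surjective (F : Set C(X, ℝ)) : Function.Surjective (toEvalImage F) :=
  rangeFactorization_surjective

theorem continuous_toEvalImage (F : Set C(X, ℝ)) : Continuous (toEvalImage F) :=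
  Continuous.subtype_mk (continuous_pi fun f => f.1.continuous) _

/-- The restriction of coordinates. -/
def evalRestrict {F G : Set C(X, ℝ)} (h : F ⊆ G) (y : EvalImage G) : EvalImage F :=
  ⟨fun f : F => y.1 ⟨f.1, h f.2⟩, by obtain ⟨_, x, rfl⟩ := y; exact ⟨x, rfl⟩⟩

theorem continuous_evalRestrict {F G : Set C(X, ℝ)} (h : F ⊆ G) : Continuous (evalRestrict h) :=
  Continuous.subtype_mk (continuous_pi fun f =>
    (continuous_apply (⟨f.1, h f.2⟩ : G)).comp continuous_subtype_val) _

/-- A set of functions containing `1` and closed under `band` for rational parameters. -/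
structure BandClosed (F : Set C(X, ℝ)) : Prop where
  one_mem : 1 ∈ F
  band_mem : ∀ (p q : ℚ) {f g : C(X, ℝ)}, f ∈ F → g ∈ F → band p q f g ∈ F

/-- The open set of the points of `EvalImage F` with positive `f`-coordinate. -/
def posImage (F : Set C(X, ℝ)) (f : F) : Set (EvalImage F) := {y | 0 < y.1 f}

theorem isOpen_posImage (F : Set C(X, ℝ)) (f : F) : IsOpen (posImage F f) :=
  isOpen_lt continuous_const ((continuous_apply f).comp continuous_subtype_val)

theorem BandClosed.isTopologicalBasis {F : Set C(X, ℝ)} (hF : BandClosed F) :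
    IsTopologicalBasis (range (posImage F)) := by
  refine isTopologicalBasis_of_isOpen_of_nhds ?_ fun y U hy hU => ?_
  · rintro _ ⟨f, rfl⟩
    exact isOpen_posImage F f
  have happ : ∀ (p q : ℚ) (f g : F) (z : EvalImage F),
      z.1 ⟨_, hF.band_mem p q f.2 g.2⟩ = min (min (z.1 f - p) (q - z.1 f)) (z.1 g) := by
    rintro p q f g ⟨_, x, rfl⟩
    rfl
  let ι := {f : F // y ∈ posImage F f}
  have : Nonempty ι := ⟨⟨⟨1, hF.one_mem⟩, by
    obtain ⟨_, x, rfl⟩ := y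
    simp [posImage]⟩⟩
  -- `band 0 q f g` with `q` above the value at `y` is positive at `y`, and only where both `f` and
  -- `g` are.
  have hdir : Directed (· ≥ ·) fun f : ι => Filter.principal (posImage F f.1) := by
    rintro ⟨f, hf⟩ ⟨g, hg⟩
    obtain ⟨q, hq⟩ := exists_rat_gt (y.1 f)
    refine ⟨⟨⟨_, hF.band_mem 0 q f.2 g.2⟩, ?_⟩, ?_, ?_⟩
    · simp only [posImage, mem_ofPred_eq] at hf hg ⊢
      rw [happ]
      simp [hf, hg, hq]
    · simp only [ge_iff_le, Filter.le_principal_iff, Filter.mem_principal]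
      intro z hz
      simp only [posImage, mem_ofPred_eq] at hz ⊢
      rw [happ] at hz
      simpa using (lt_min_iff.1 (lt_min_iff.1 hz).1).1
    · simp only [ge_iff_le, Filter.le_principal_iff, Filter.mem_principal]
      intro z hz
      simp only [posImage, mem_ofPred_eq] at hz ⊢
      rw [happ] at hz
      exact (lt_min_iff.1 hz).2
  have hle : ⨅ f : ι, Filter.principal (posImage F f.1) ≤ 𝓝 y := by
    rw [nhds_subtype_eq_comap, nhds_pi, Filter.pi, Filter.comap_iInf]
    refine le_iInf fun f => ?_
    rw [Filter.comap_comap]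
    rintro s ⟨t, ht, hts⟩
    obtain ⟨a, b, ⟨ha, hb⟩, hab⟩ := mem_nhds_iff_exists_Ioo_subset.1 ht
    obtain ⟨p, hap, hp⟩ := exists_rat_btwn ha
    obtain ⟨q, hq, hqb⟩ := exists_rat_btwn hb
    have h1 := hF.one_mem
    -- With `g = 1` the third term of the minimum imposes no condition, leaving `p < f < q`.
    have hmem : y ∈ posImage F ⟨_, hF.band_mem p q f.2 h1⟩ := by
      simp only [posImage, mem_ofPred_eq]
      rw [happ p q f ⟨1, h1⟩]
      obtain ⟨_, x, rfl⟩ := y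
      simp only [lt_min_iff, sub_pos]
      exact ⟨⟨hp, hq⟩, by simp⟩
    refine Filter.mem_of_superset (Filter.mem_iInf_of_mem ⟨_, hmem⟩ (Filter.mem_principal_self _))
      fun z hz => hts (hab ?_)
    simp only [posImage, mem_ofPred_eq] at hz
    rw [happ p q f ⟨1, h1⟩] at hz
    simp only [lt_min_iff, sub_pos] at hz
    exact ⟨hap.trans hz.1.1, hz.1.2.trans hqb⟩
  obtain ⟨f, hf⟩ := (Filter.mem_iInf_of_directed hdir U).1 (hle (hU.mem_nhds hy))
  exact ⟨posImage F f.1, ⟨f.1, rfl⟩, f.2, hf⟩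

theorem BandClosed.weight_le {F : Set C(X, ℝ)} (hF : BandClosed F) : weight (EvalImage F) ≤ #F :=
  le_trans (csInf_le' (mem_ofPred.2 ⟨_, hF.isTopologicalBasis, rfl⟩)) mk_range_le

/-- If the closure of the image of an open set `U` has empty interior, then any positivity set of a
member of `F` contains one missing `U`. -/
theorem BandClosed.exists_posSet_disjoint {F : Set C(X, ℝ)} (hF : BandClosed F) {U : Set X}
    (hU : ¬(interior (closure (toEvalImage F '' U))).Nonempty) {f : C(X, ℝ)} (hf : f ∈ F)
    (hne : (posSet f : Set X).Nonempty) :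
    ∃ g ∈ F, (posSet g : Set X).Nonempty ∧ (posSet g : Set X) ⊆ posSet f ∧
      Disjoint (posSet g : Set X) U := by
  obtain ⟨x, hx⟩ := hne
  have hnot : ¬ posImage F ⟨f, hf⟩ ⊆ closure (toEvalImage F '' U) := fun h =>
    hU ⟨toEvalImage F x, interior_maximal h (isOpen_posImage F _) hx⟩
  obtain ⟨y, hy, hyU⟩ := not_subset.1 hnot
  obtain ⟨_, ⟨g, rfl⟩, hyg, hg⟩ := hF.isTopologicalBasis.exists_subset_of_mem_open
    (⟨hy, hyU⟩ : y ∈ posImage F ⟨f, hf⟩ \ closure (toEvalImage F '' U))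
    ((isOpen_posImage F _).sdiff isClosed_closure)
  obtain ⟨z, rfl⟩ := toEvalImage_surjective F y
  refine ⟨g, g.2, ⟨z, hyg⟩, fun w hw => ?_, disjoint_left.2 fun w hw hwU => ?_⟩
  · exact (hg (a := toEvalImage F w) hw).1
  · exact (hg (a := toEvalImage F w) hw).2 (subset_closure (mem_image_of_mem _ hwU))

end

end OpenOpenGame

/-! ### Strategies on functions and skeletal maps -/

namespace OpenOpenGame

section
variable {X : Type u} [TopologicalSpace X]

/-- `s` is a winning strategy of Player I in the open-open game with rounds indexed by `K` in which
both players choose functions, standing for the sets where they are positive. -/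
structure FunStrategy {K : Type u} [LinearOrder K]
    (s : ∀ k : K, (Iio k → C(X, ℝ)) → C(X, ℝ)) : Prop where
  nonempty : ∀ k a, (posSet (s k a) : Set X).Nonempty
  dense : ∀ B : K → C(X, ℝ), (∀ k, (posSet (B k) : Set X).Nonempty) →
    (∀ k, (posSet (B k) : Set X) ⊆ posSet (s k fun i => B i)) → Dense (⋃ k, (posSet (B k) : Set X))

theorem Favorable.exists_funStrategy [CompletelyRegularSpace X] [Nonempty X] {κ : Cardinal.{u}}
    (h : Favorable X κ) :
    ∃ s : ∀ k : κ.ord.ToType, (Iio k → C(X, ℝ)) → C(X, ℝ), FunStrategy s := by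
  classical
  obtain ⟨s, hs⟩ := h
  have hc : ∀ U : NOpens X, ∃ f : C(X, ℝ), (posSet f : Set X).Nonempty ∧ (posSet f : Set X) ⊆ U.1 :=
    fun ⟨U, x, hx⟩ => (exists_posSet_subset U.2 hx).imp fun f hf => ⟨⟨x, hf.1⟩, hf.2⟩
  choose c hc0 hcU using hc
  -- The whole space is a dummy move for functions that are nowhere positive; it never occurs in a
  -- legal play.
  let N : C(X, ℝ) → NOpens X := fun f =>
    if hf : (posSet f : Set X).Nonempty then ⟨posSet f, hf⟩ else ⟨⊤, univ_nonempty⟩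
  have hN : ∀ f, (posSet f : Set X).Nonempty → (N f).1 = posSet f := fun f hf => by simp [N, hf]
  let e := Ordinal.ToType.mk (o := κ.ord)
  refine ⟨fun k a => c (s (e.symm k) fun γ => N (a ⟨e γ, e.lt_symm_apply.1 γ.2⟩)),
    fun _ _ => hc0 _, fun B hB hBs => ?_⟩
  have hd := hs (fun α => N (B (e α))) fun α => by
    rw [hN _ (hB _)]
    -- The type of the history depends on the round, so `e.symm (e α) = α` is applied through a
    -- general `β`.
    have heq : ∀ β, β = α → ((s β fun γ => N (B (e γ))).1 : Set X) ⊆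
        ((s α fun γ => N (B (e γ))).1 : Set X) := by
      rintro _ rfl
      exact fun _ h => h
    exact (hBs (e α)).trans ((hcU _).trans (heq _ (e.symm_apply_apply α)))
  refine hd.mono (iUnion_subset fun α => ?_)
  rw [hN _ (hB _)]
  exact subset_iUnion (fun k => (posSet (B k) : Set X)) _

/-- If `U` were a counterexample, Player II could always answer inside `F` with a set missing `U`:
Player I's moves stay in `F`, where such answers exist. The resulting play would contradict density.
-/
theorem isSkeletal_toEvalImage {K : Type u} [LinearOrder K] [WellFoundedLT K]
    {s : ∀ k : K, (Iio k → C(X, ℝ)) → C(X, ℝ)} (hs : FunStrategy s) {F : Set C(X, ℝ)}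
    (hF : BandClosed F) (hsF : OpClosed s F) : IsSkeletal (toEvalImage F) := by
  refine ⟨continuous_toEvalImage F, toEvalImage_surjective F, fun U hUo hUne => ?_⟩
  by_contra hU
  have hc : ∀ f : F, ∃ g : F, (posSet f.1 : Set X).Nonempty → (posSet g.1 : Set X).Nonempty ∧
      (posSet g.1 : Set X) ⊆ posSet f.1 ∧ Disjoint (posSet g.1 : Set X) U := fun f => by
    by_cases hf : (posSet f.1 : Set X).Nonempty
    · obtain ⟨g, hg, h⟩ := hF.exists_posSet_disjoint hU f.2 hf
      exact ⟨⟨g, hg⟩, fun _ => h⟩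
    · exact ⟨f, fun h => absurd h hf⟩
  choose c hc using hc
  let step : ∀ k : K, (∀ i, i < k → F) → F := fun k b =>
    c ⟨s k fun i => b i i.2, hsF k _ fun i => (b i i.2).2⟩
  let B : K → F := wellFounded_lt.fix step
  have hB : ∀ k, B k = c ⟨s k fun i => B i, hsF k _ fun i => (B i).2⟩ := fun k =>
    wellFounded_lt.fix_eq step k
  have hBc := fun k => hc ⟨s k fun i => B i, hsF k _ fun i => (B i).2⟩ (hs.nonempty k _)
  simp only [← hB] at hBc
  obtain ⟨x, hxU, hx⟩ := (hs.dense (fun k => B k) (fun k => (hBc k).1)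
    fun k => (hBc k).2.1).inter_open_nonempty U hUo hUne
  obtain ⟨k, hk⟩ := mem_iUnion.1 hx
  exact disjoint_left.1 (hBc k).2.2 hk hxU

theorem IsSkeletal.of_comp {Y Z : Type u} [TopologicalSpace Y] [TopologicalSpace Z] {p : X → Y}
    {f : Y → Z} (hp : Continuous p) (hps : Function.Surjective p) (hf : Continuous f)
    (h : IsSkeletal (f ∘ p)) : IsSkeletal f := by
  refine ⟨hf, h.2.1.of_comp, fun U hU hne => ?_⟩
  have := h.2.2 (p ⁻¹' U) (hU.preimage hp) (hne.preimage hps)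
  rwa [image_comp, image_preimage_eq U hps] at this

end

end OpenOpenGame

/-! ### The inverse system and its limit -/

namespace OpenOpenGame

section
variable {X : Type u} [TopologicalSpace X]

/-- The arities of the operations `functionOp`. -/
abbrev FunctionArity (K : Type u) [LinearOrder K] : K ⊕ ULift.{u} (ℚ × ℚ) → Type u :=
  Sum.elim (fun k => Iio k) fun _ => ULift.{u} Bool

/-- The moves of a strategy together with the operations `band`. -/
def functionOp {K : Type u} [LinearOrder K] (s : ∀ k : K, (Iio k → C(X, ℝ)) → C(X, ℝ)) :
    ∀ j, (FunctionArity K j → C(X, ℝ)) → C(X, ℝ)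
  | .inl k, a => s k a
  | .inr p, a => band p.down.1 p.down.2 (a ⟨true⟩) (a ⟨false⟩)

section
variable {K : Type u} [LinearOrder K] {s : ∀ k : K, (Iio k → C(X, ℝ)) → C(X, ℝ)}
  {F : Set C(X, ℝ)}

theorem OpClosed.strategy (h : OpClosed (functionOp s) F) : OpClosed s F :=
  fun k a ha => h (.inl k) a ha

theorem OpClosed.bandClosed (h : OpClosed (functionOp s) F) (h1 : 1 ∈ F) : BandClosed F where
  one_mem := h1
  band_mem p q f g hf hg := h (.inr ⟨p, q⟩) (fun b => cond b.down f g) fun b => by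
    obtain ⟨_ | _⟩ := b
    exacts [hg, hf]

/-- The closed sets of functions of size at most `τ`: the index set of the inverse system. -/
abbrev FunctionIndex (s : ∀ k : K, (Iio k → C(X, ℝ)) → C(X, ℝ)) (τ : Cardinal.{u}) : Type u :=
  {F : Set C(X, ℝ) // 1 ∈ F ∧ OpClosed (functionOp s) F ∧ #F ≤ τ}

/-- The inverse system of the evaluation images. -/
def evalSystem (s : ∀ k : K, (Iio k → C(X, ℝ)) → C(X, ℝ)) (τ : Cardinal.{u}) :
    InvSystem (FunctionIndex s τ) where
  space F := EvalImage F.1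
  bond _ _ h := evalRestrict h
  continuous_bond _ _ h := continuous_evalRestrict h
  bond_self _ _ := rfl
  bond_bond _ _ _ _ _ _ := rfl

/-- The canonical map into the limit of the inverse system of evaluation images. -/
def toEvalLimit (s : ∀ k : K, (Iio k → C(X, ℝ)) → C(X, ℝ)) (τ : Cardinal.{u}) (x : X) :
    (evalSystem s τ).Limit := ⟨fun F => toEvalImage F.1 x, fun _ _ _ => rfl⟩

end

section
variable {κ : Cardinal.{u}} {s : ∀ k : κ.ord.ToType, (Iio k → C(X, ℝ)) → C(X, ℝ)}

/-- Minimality provides least upper bounds: apply this to the union of the given indices. -/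
theorem exists_functionIndex (hκ : ℵ₀ ≤ κ) {A : Set C(X, ℝ)} (hA : #A ≤ tau κ) :
    ∃ F : FunctionIndex s (tau κ), A ⊆ F.1 ∧
      ∀ G : FunctionIndex s (tau κ), A ⊆ G.1 → F ≤ G := by
  have hτ : ℵ₀ ≤ tau κ := hκ.trans (le_tau hκ)
  refine ⟨⟨opClosure (functionOp s) (insert 1 A), subset_opClosure _ _ (mem_insert _ _),
    opClosed_opClosure _ _, mk_opClosure_le _ hτ ?_ ?_ ?_⟩,
    (subset_insert _ _).trans (subset_opClosure _ _),
    fun G hG => opClosure_subset _ (insert_subset G.2.1 hG) G.2.2.1⟩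
  · have h : #(ULift.{u} (ℚ × ℚ)) ≤ ℵ₀ := mk_le_aleph0
    simpa using add_le_of_le hτ (le_tau hκ) (h.trans hτ)
  · rintro (k | p)
    · refine tau_power_le hκ ?_
      simpa [FunctionArity] using mk_Iio_lt k
    · refine tau_power_le hκ ((lt_aleph0_of_finite (ULift.{u} Bool)).trans_le hκ)
  · exact mk_insert_le.trans (add_le_of_le hτ hA (one_le_aleph0.trans hτ))

theorem isCompleteDirected_functionIndex (hκ : ℵ₀ ≤ κ) :
    IsCompleteDirected (FunctionIndex s (tau κ)) (tau κ) := by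
  have hτ : ℵ₀ ≤ tau κ := hκ.trans (le_tau hκ)
  refine ⟨?_, ⟨fun F G => ?_⟩, fun A _ hA => ?_⟩
  · obtain ⟨F, -⟩ := exists_functionIndex (s := s) hκ (A := ∅) (by simp)
    exact ⟨F⟩
  · obtain ⟨H, hH, -⟩ := exists_functionIndex (s := s) hκ (A := F.1 ∪ G.1)
      ((mk_union_le _ _).trans (add_le_of_le hτ F.2.2.2 G.2.2.2))
    exact ⟨H, subset_union_left.trans hH, subset_union_right.trans hH⟩
  · obtain ⟨H, hH, hmin⟩ := exists_functionIndex (s := s) hκ (A := ⋃ F : A, F.1.1)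
      ((mk_iUnion_le _).trans (mul_le_of_le hτ hA (ciSup_le' fun F => F.1.2.2.2)))
    exact ⟨H, fun F hF => (subset_iUnion (fun F : A => F.1.1) ⟨F, hF⟩).trans hH,
      fun G hG => hmin G (iUnion_subset fun F => hG F.2)⟩

/-- As the indices are directed, each neighbourhood in the limit contains one determined by a single
coordinate, and `X` maps onto every coordinate space. -/
theorem denseRange_toEvalLimit (hκ : ℵ₀ ≤ κ) : DenseRange (toEvalLimit s (tau κ)) := by
  obtain ⟨hne, hdir, -⟩ := isCompleteDirected_functionIndex (s := s) hκ
  let S := evalSystem s (tau κ)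
  intro z
  rw [mem_closure_iff_nhds]
  intro U hU
  have hanti : Antitone fun F => Filter.comap (fun w : S.Limit => w.1 F) (𝓝 (z.1 F)) := by
    intro F G h
    have hw : (fun w : S.Limit => w.1 F) = S.bond h ∘ fun w => w.1 G :=
      funext fun w => (w.2 h).symm
    dsimp only
    rw [hw, ← z.2 h, ← Filter.comap_comap]
    exact Filter.comap_mono (Filter.tendsto_iff_comap.1 (S.continuous_bond h).continuousAt)
  have hle : ⨅ F, Filter.comap (fun w : S.Limit => w.1 F) (𝓝 (z.1 F)) ≤ 𝓝 z := by
    rw [nhds_subtype_eq_comap, nhds_pi, Filter.pi, Filter.comap_iInf]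
    exact iInf_mono fun F => by rw [Filter.comap_comap]; exact le_rfl
  obtain ⟨F, V, hV, hVU⟩ := (Filter.mem_iInf_of_directed hanti.directed_ge U).1 (hle hU)
  obtain ⟨x, hx⟩ := toEvalImage_surjective F.1 (z.1 F)
  refine ⟨toEvalLimit s (tau κ) x, hVU ?_, mem_range_self x⟩
  change toEvalImage F.1 x ∈ V
  rw [hx]
  exact mem_of_mem_nhds hV

theorem isDenseEmbedding_toEvalLimit [T35Space X] (hκ : ℵ₀ ≤ κ) :
    IsDenseEmbedding (toEvalLimit s (tau κ)) := by
  have hind : IsInducing (toEvalLimit s (tau κ)) := by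
    rw [isInducing_iff_nhds]
    intro x
    have hcont : Continuous (toEvalLimit s (tau κ)) :=
      Continuous.subtype_mk (continuous_pi fun F => continuous_toEvalImage F.1) _
    refine le_antisymm (Filter.tendsto_iff_comap.1 hcont.continuousAt) fun U hU => ?_
    obtain ⟨V, hVU, hV, hxV⟩ := mem_nhds_iff.1 hU
    obtain ⟨f, hxf, hf⟩ := exists_posSet_subset hV hxV
    -- The basic set `posSet f` is pulled back from any coordinate `F` containing `f`.
    obtain ⟨F, hF, -⟩ := exists_functionIndex (s := s) hκ (A := {f})
      (by simpa using one_le_aleph0.trans (hκ.trans (le_tau hκ)))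
    have hfF : f ∈ F.1 := hF rfl
    refine ⟨(fun w : (evalSystem s (tau κ)).Limit => w.1 F) ⁻¹' posImage F.1 ⟨f, hfF⟩, ?_,
      fun y hy => hVU (hf hy)⟩
    exact ((isOpen_posImage F.1 ⟨f, hfF⟩).preimage
      ((continuous_apply F).comp continuous_subtype_val)).mem_nhds hxf
  exact ⟨⟨hind, denseRange_toEvalLimit hκ⟩, hind.injective⟩

end

end

end OpenOpenGame

theorem theorem4p6 (X : Type u) [TopologicalSpace X] [Nonempty X] [T35Space X]
    (κ : Cardinal.{u}) (hκ : OpenOpenGame.mu X = κ) :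
    ∃ (I : Type u) (_ : PartialOrder I) (S : OpenOpenGame.InvSystem I),
      OpenOpenGame.IsCompleteDirected I (OpenOpenGame.tau κ) ∧
      (∀ ⦃i j : I⦄ (h : i ≤ j), OpenOpenGame.IsSkeletal (S.bond h)) ∧
      (∀ i : I, T35Space (S.space i)) ∧
      (∀ i : I, OpenOpenGame.weight (S.space i) ≤ OpenOpenGame.tau κ) ∧
      ∃ f : X → S.Limit, IsDenseEmbedding f := by
  obtain ⟨h0, hfav⟩ := OpenOpenGame.mu_spec X
  rw [hκ] at h0 hfav
  obtain ⟨s, hs⟩ := hfav.exists_funStrategy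
  refine ⟨OpenOpenGame.FunctionIndex s (OpenOpenGame.tau κ), inferInstance,
    OpenOpenGame.evalSystem s _, OpenOpenGame.isCompleteDirected_functionIndex h0,
    fun F G h => ?_, fun F => ?_, fun F => ?_, _, OpenOpenGame.isDenseEmbedding_toEvalLimit h0⟩
  · exact .of_comp (OpenOpenGame.continuous_toEvalImage G.1)
      (OpenOpenGame.toEvalImage_surjective G.1) (OpenOpenGame.continuous_evalRestrict h)
      (OpenOpenGame.isSkeletal_toEvalImage hs (F.2.2.1.bandClosed F.2.1) F.2.2.1.strategy)
  · exact inferInstanceAs (T35Space (OpenOpenGame.EvalImage F.1))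
  · exact (F.2.2.1.bandClosed F.2.1).weight_le.trans F.2.2.2
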